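/- Let $\mathcal A$ be an Archimedean real vector lattice with an associative bilinear multiplication (possibly without a unit) that makes it an $f$-algebra: $ab\ge 0$ whenever $a,b\ge 0$, and $a\wedge b=0$, $c\ge 0$ imply $(ac)\wedge b=(ca)\wedge b=0$. Assume that $\mathcal A$ is semiprime (zero is its only nilpotent element) and uniformly complete (for every $u\ge 0$, every sequence $(f_n)$ such that for each $\varepsilon>0$ one has $|f_m-f_n|\le\varepsilon u$ for all large $m,n$ admits $f\in\mathcal A$ such that for each $\varepsilon>0$ one has $|f_n-f|\le\varepsilon u$ for all large $n$). For a vector lattice $V$, an element $z\ge 0$ of $V$ is a majorant of $\varphi\in V$ if for every $x\in V$ there is $c_x>0$ with $|x|\wedge n|\varphi|\le c_x z$ for all $n\in\mathbb N$. Let $\Phi_1(V)$ be the set of finite elements (those that have a majorant), $\Phi_2(V)$ the set of totally finite elements (those that have a majorant which is itself finite), and $\Phi_3(V)=S_+(V)-S_+(V)$, where $S_+(V)$ is the set of positive self-majorizing elements (those $\varphi\ge 0$ that are a majorant of themselves). Let $p\ge 2$ be an integer and $\Pi_p(\mathcal A)=\{g_1\cdots g_p : g_1,\dots,g_p\in\mathcal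 A\}$. Then $\Pi_p(\mathcal A)$ is a subalgebra and a sublattice of $\mathcal A$, hence a vector lattice under the induced order and operations, and for $i=1,2,3$ \[ \{g_1\cdots g_p : g_1,\dots,g_p\in\Phi_i(\mathcal A)\}=\Phi_i\big(\Pi_p(\mathcal A)\big). \] -/

import Mathlib

section VectorLattice

/-- The Archimedean property of a vector lattice. (Mathlib's `Archimedean` is a different notion for
orders that are not total.) -/
def IsArchimedeanLattice (V : Type*) [AddCommGroup V] [Lattice V] : Prop :=
  ∀ x y : V, 0 ≤ x → (∀ n : ℕ, n • x ≤ y) → x = 0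

/-- Relatively uniform completeness: for every `u ≥ 0`, every `u`-uniform Cauchy sequence has a
`u`-uniform limit. -/
def IsUniformlyComplete (V : Type*) [AddCommGroup V] [Lattice V] [Module ℝ V] : Prop :=
  ∀ u : V, 0 ≤ u → ∀ f : ℕ → V,
    (∀ ε : ℝ, 0 < ε → ∃ N : ℕ, ∀ m ≥ N, ∀ n ≥ N, |f m - f n| ≤ ε • u) →
    ∃ g : V, ∀ ε : ℝ, 0 < ε → ∃ N : ℕ, ∀ n ≥ N, |f n - g| ≤ ε • u

/-- `z` is a majorant of `φ` in the vector lattice `V`. -/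
def IsMajorant {V : Type*} [AddCommGroup V] [Lattice V] [Module ℝ V] (z φ : V) : Prop :=
  0 ≤ z ∧ ∀ x : V, ∃ c : ℝ, 0 < c ∧ ∀ n : ℕ, |x| ⊓ n • |φ| ≤ c • z

/-- `Φ₁(V)`: the finite elements of `V`. -/
def finiteElements (V : Type*) [AddCommGroup V] [Lattice V] [Module ℝ V] : Set V :=
  {φ | ∃ z : V, IsMajorant z φ}

/-- `Φ₂(V)`: the totally finite elements of `V`. -/
def totallyFiniteElements (V : Type*) [AddCommGroup V] [Lattice V] [Module ℝ V] : Set V :=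
  {φ | ∃ z ∈ finiteElements V, IsMajorant z φ}

/-- `S₊(V)`: the positive self-majorizing elements of `V`. -/
def positiveSelfMajorizing (V : Type*) [AddCommGroup V] [Lattice V] [Module ℝ V] : Set V :=
  {φ | 0 ≤ φ ∧ IsMajorant |φ| φ}

/-- `Φ₃(V) = S₊(V) - S₊(V)`. -/
def selfMajorizingDifferences (V : Type*) [AddCommGroup V] [Lattice V] [Module ℝ V] : Set V :=
  {φ | ∃ s ∈ positiveSelfMajorizing V, ∃ t ∈ positiveSelfMajorizing V, φ = s - t}

end VectorLattice

section Products

/-- The product `g 0 * g 1 * ⋯ * g (p - 1)` in an algebra that need not have a unit. Only `p ≥ 1` is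
meaningful; the value at `p = 0` is a convention that is never used. -/
def foldProd {A : Type*} [NonUnitalRing A] : (p : ℕ) → (Fin p → A) → A
  | 0, _ => 0
  | 1, g => g 0
  | n + 2, g => foldProd (n + 1) (fun i => g i.castSucc) * g (Fin.last (n + 1))

/-- The set of all `p`-fold products of elements of `S`. -/
def foldProducts {A : Type*} [NonUnitalRing A] (p : ℕ) (S : Set A) : Set A :=
  {a | ∃ g : Fin p → A, (∀ i, g i ∈ S) ∧ foldProd p g = a}

/-- Zero is the only nilpotent element. -/
def IsSemiprimeAlgebra (A : Type*) [NonUnitalRing A] : Prop :=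
  ∀ a : A, (∃ n : ℕ, 1 ≤ n ∧ foldProd n (fun _ => a) = 0) → a = 0

end Products

section FAlgebra

/-- The conditions that make a vector lattice with an associative bilinear multiplication
an `f`-algebra. -/
structure IsFAlgebra (A : Type*) [NonUnitalRing A] [Lattice A] : Prop where
  mul_nonneg : ∀ a b : A, 0 ≤ a → 0 ≤ b → 0 ≤ a * b
  mul_right_disjoint : ∀ a b c : A, a ⊓ b = 0 → 0 ≤ c → (a * c) ⊓ b = 0
  mul_left_disjoint : ∀ a b c : A, a ⊓ b = 0 → 0 ≤ c → (c * a) ⊓ b = 0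

/-- A subalgebra that is also a sublattice, with the induced order and operations. -/
structure LatticeSubalgebra (A : Type*) [NonUnitalRing A] [Lattice A] [Module ℝ A]
    extends NonUnitalSubalgebra ℝ A where
  sup_mem' : ∀ {a b : A}, a ∈ carrier → b ∈ carrier → a ⊔ b ∈ carrier
  inf_mem' : ∀ {a b : A}, a ∈ carrier → b ∈ carrier → a ⊓ b ∈ carrier

/-- The lattice structure of a lattice subalgebra, for the order induced from `A`. -/
instance LatticeSubalgebra.instLattice {A : Type*} [NonUnitalRing A] [Lattice A] [Module ℝ A]
    (P : LatticeSubalgebra A) : Lattice P.toNonUnitalSubalgebra :=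
  Subtype.lattice (fun _ _ ha hb => P.sup_mem' ha hb) (fun _ _ ha hb => P.inf_mem' ha hb)

instance LatticeSubalgebra.instIsOrderedAddMonoid {A : Type*} [NonUnitalRing A] [Lattice A]
    [Module ℝ A] [IsOrderedAddMonoid A] (P : LatticeSubalgebra A) :
    IsOrderedAddMonoid P.toNonUnitalSubalgebra where
  add_le_add_left a b h c := add_le_add_left (show (a : A) ≤ b from h) (c : A)

instance LatticeSubalgebra.instPosSMulMono {A : Type*} [NonUnitalRing A] [Lattice A]
    [Module ℝ A] [PosSMulMono ℝ A] (P : LatticeSubalgebra A) :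
    PosSMulMono ℝ P.toNonUnitalSubalgebra where
  smul_le_smul_of_nonneg_left c hc a b h :=
    show c • (a : A) ≤ c • (b : A) from
      smul_le_smul_of_nonneg_left (show (a : A) ≤ b from h) hc

end FAlgebra

/-! On the positive cone, `w ↦ w ^ p` preserves and reflects the order, preserves binary infima and
suprema, and sends `x ⊓ k • w` to `x ^ p ⊓ k ^ p • w ^ p`. If the positive elements of `Π_p` are
exactly the `p`-th powers of positive elements, then majorants, being defined by such infima,
correspond under this map, and so do the three classes of finite elements.

Signed elements are handled through solidity. If `c`, `d` are the roots of `y⁺`, `y⁻`, then `y = (c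
+ d) ^ (p - 1) * (c - d)` with `|c - d| ≤ c + d`; conversely a product of the `g i` is dominated by
`u ^ p`, where `u` is the sum of the `|g i|`.

The real work is the existence of roots of `a ^ p - b ^ p` and of `a ^ (p - 1) * b`. Both are
homogeneous functions of two elements `0 ≤ f ≤ e`, equal to `q t • e ^ p` up to an error controlled
by `|f - t • e|`. Finite suprema of explicit elements approximate the root, and uniform completeness
supplies the limit. No unit or representation by functions is used:
`le_map_step_of_forall_le_map_abs`, which bounds the infimum of the `|N • f - k • e|` by `e`,
replaces the choice of a grid point close to a function value. The same bound makes the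
multiplication commutative. -/

set_option linter.unusedSectionVars false

/-! ### Disjointness and arithmetic progressions in lattice-ordered groups -/

section LatticeGroup

variable {V W : Type*} [AddCommGroup V] [Lattice V] [IsOrderedAddMonoid V]

theorem sub_inf_inf_sub_inf (a b : V) : (a - a ⊓ b) ⊓ (b - a ⊓ b) = 0 := by
  rw [← inf_sub, sub_self]

theorem sup_sub_inf_sup_sub (a b : V) : (a ⊔ b - a) ⊓ (a ⊔ b - b) = 0 := by
  rw [← sub_sup, sub_self]

theorem inf_add_le {x a b : V} (hx : 0 ≤ x) (ha : 0 ≤ a) (hb : 0 ≤ b) :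
    x ⊓ (a + b) ≤ x ⊓ a + x ⊓ b := by
  rw [add_inf, inf_add, inf_add]
  exact le_inf (le_inf (inf_le_left.trans (le_add_of_nonneg_right hx))
    (inf_le_left.trans (le_add_of_nonneg_left ha)))
    (le_inf (inf_le_left.trans (le_add_of_nonneg_right hb)) inf_le_right)

theorem abs_sub_le_add {a b : V} (ha : 0 ≤ a) (hb : 0 ≤ b) : |a - b| ≤ a + b := by
  rw [abs_le']
  exact ⟨(sub_le_self a hb).trans (le_add_of_nonneg_right hb),
    by rw [neg_sub]; exact (sub_le_self b ha).trans (le_add_of_nonneg_left ha)⟩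

/-- An additive map that preserves disjointness preserves binary infima. -/
theorem AddMonoidHom.map_inf_of_disjoint [AddCommGroup W] [Lattice W] [IsOrderedAddMonoid W]
    (T : V →+ W) (hT : ∀ a b, a ⊓ b = 0 → T a ⊓ T b = 0) (a b : V) :
    T (a ⊓ b) = T a ⊓ T b := by
  have h := hT _ _ (sub_inf_inf_sub_inf a b)
  rw [map_sub, map_sub, ← inf_sub, sub_eq_zero] at h
  exact h.symm

/-- If an arithmetic progression with difference `-e` goes from a nonnegative to a nonpositive
element, then the infimum of the moduli of its terms is at most `e`; here in the form of a rule
that bounds an element below the images of these moduli under an inf-preserving map. -/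
theorem le_map_step_of_forall_le_map_abs [Lattice W] (T : V → W)
    (hT : ∀ a b, T (a ⊓ b) = T a ⊓ T b) {e : V} (he : 0 ≤ e) (a : ℕ → V) (N : ℕ)
    (h0 : 0 ≤ a 0) (hN : a N ≤ 0) (hstep : ∀ k, a k - e = a (k + 1)) {x : W}
    (hx : ∀ k ≤ N, x ≤ T |a k|) : x ≤ T e := by
  have hmono : Monotone T := fun u v huv => by
    rw [← inf_eq_left.2 huv, hT]; exact inf_le_right
  let _ := AddCommGroup.toDistribLattice V
  have key : ∀ m ≤ N, x ≤ T (e ⊔ a m) := by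
    intro m
    induction m with
    | zero =>
      intro h
      refine (hx 0 h).trans (hmono ?_)
      rw [abs_of_nonneg h0]; exact le_sup_right
    | succ m ih =>
      intro h
      refine (le_inf (ih (by omega)) (hx _ h)).trans ?_
      rw [← hT]
      refine hmono ?_
      rw [inf_sup_right]
      refine sup_le (inf_le_left.trans le_sup_left) ?_
      rw [abs, inf_sup_left]
      refine sup_le (inf_le_right.trans le_sup_right) (le_sup_of_le_left ?_)
      rw [← hstep, neg_sub]
      -- Twice this infimum is at most `a m + (e - a m) = e`, so the infimum itself is at most `e`.
      have h1 := inf_le_left (a := a m) (b := e - a m)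
      have h2 := inf_le_right (a := a m) (b := e - a m)
      rw [← sub_nonneg]
      refine nsmul_two_semiclosed ?_
      rw [two_nsmul]
      have h3 := add_le_add h1 h2
      rw [add_sub_cancel] at h3
      have h4 : 0 ≤ e + (e - (a m ⊓ (e - a m) + a m ⊓ (e - a m))) :=
        add_nonneg he (sub_nonneg.2 h3)
      refine h4.trans (le_of_eq ?_)
      abel
  exact (key N le_rfl).trans (hmono (sup_le le_rfl (hN.trans he)))

theorem eq_zero_of_abs_eq_zero {x : V} (h : |x| = 0) : x = 0 :=
  le_antisymm (h ▸ le_abs_self x) (neg_nonpos.1 (h ▸ neg_le_abs x))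

end LatticeGroup

/-! ### Scalars, moduli and the Archimedean property -/

section VectorLattice

variable {V : Type*} [AddCommGroup V] [Lattice V] [Module ℝ V] [PosSMulMono ℝ V]

theorem smul_inf_of_pos {c : ℝ} (hc : 0 < c) (x y : V) : c • (x ⊓ y) = c • x ⊓ c • y :=
  (OrderIso.smulRight (β := V) hc).map_inf x y

theorem smul_sup_of_pos {c : ℝ} (hc : 0 < c) (x y : V) : c • (x ⊔ y) = c • x ⊔ c • y :=
  (OrderIso.smulRight (β := V) hc).map_sup x y

variable [IsOrderedAddMonoid V]

theorem abs_smul_of_nonneg {c : ℝ} (hc : 0 ≤ c) (x : V) : |c • x| = c • |x| := by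
  rcases hc.eq_or_lt with rfl | hc
  · simp
  · rw [abs, abs, smul_sup_of_pos hc, smul_neg]

theorem abs_nsmul_eq (n : ℕ) (x : V) : |n • x| = n • |x| := by
  rw [← Nat.cast_smul_eq_nsmul ℝ, ← Nat.cast_smul_eq_nsmul ℝ, abs_smul_of_nonneg n.cast_nonneg]

/-- In an Archimedean vector lattice an element whose modulus is below every positive multiple of
a fixed element vanishes. -/
theorem IsArchimedeanLattice.eq_zero_of_forall_abs_le (harch : IsArchimedeanLattice V) {x y : V}
    (h : ∀ ε : ℝ, 0 < ε → |x| ≤ ε • y) : x = 0 := by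
  refine eq_zero_of_abs_eq_zero (harch _ y (abs_nonneg x) fun n => ?_)
  have hy : 0 ≤ y := by simpa using (abs_nonneg x).trans (h 1 one_pos)
  rcases Nat.eq_zero_or_pos n with rfl | hn
  · simpa using hy
  · have hn' : (0 : ℝ) < n := by exact_mod_cast hn
    have := smul_le_smul_of_nonneg_left (h (n : ℝ)⁻¹ (by positivity)) hn'.le
    rwa [smul_smul, mul_inv_cancel₀ hn'.ne', one_smul, Nat.cast_smul_eq_nsmul] at this

end VectorLattice

/-! ### Commutativity of Archimedean `f`-algebras -/

section Commutativity

variable {A : Type*} [NonUnitalRing A] [Lattice A] [IsOrderedAddMonoid A]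
  [Module ℝ A] [PosSMulMono ℝ A]

/-- The commutator with `e` does not see multiples of `e`: that of `n • f - k • e` is `n • (f * e -
e * f)` for every `k`. Its modulus is at most `T |n • f - k • e|`, so letting `k` run from `0` to
`n` bounds `n • |f * e - e * f|` by `T e`, independently of `n`. -/
theorem IsFAlgebra.mul_comm_of_le (hA : IsFAlgebra A) (harch : IsArchimedeanLattice A) {e f : A}
    (hf : 0 ≤ f) (hfe : f ≤ e) : f * e = e * f := by
  have he := hf.trans hfe
  let T : A →+ A := AddMonoidHom.mulLeft e + AddMonoidHom.mulRight e
  have hTa (x : A) : T x = e * x + x * e := rfl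
  have hT : ∀ a b, a ⊓ b = 0 → T a ⊓ T b = 0 := by
    intro a b hab
    have hpos : ∀ a b : A, a ⊓ b = 0 → 0 ≤ a := fun a b h => h ▸ inf_le_left
    have key : ∀ a b : A, a ⊓ b = 0 → T a ⊓ b = 0 := by
      intro a b hab
      have h1 := hA.mul_left_disjoint a b e hab he
      have h2 := hA.mul_right_disjoint a b e hab he
      have hb := hpos b a (by rwa [inf_comm])
      refine le_antisymm ?_ (le_inf (add_nonneg (hpos _ _ h1) (hpos _ _ h2)) hb)
      rw [inf_comm, hTa]
      refine (inf_add_le hb (hpos _ _ h1) (hpos _ _ h2)).trans ?_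
      rw [inf_comm b, h1, inf_comm b, h2, add_zero]
    have := key _ _ (by rw [inf_comm]; exact key a b hab : b ⊓ T a = 0)
    rwa [inf_comm] at this
  have hTinf := T.map_inf_of_disjoint hT
  have hmono : Monotone T := fun u v huv => by
    rw [← inf_eq_left.2 huv, hTinf]; exact inf_le_right
  have habs : ∀ x : A, |x * e - e * x| ≤ T |x| := by
    have h1 : ∀ x : A, x * e - e * x ≤ T |x| := by
      intro x
      have h1 : x * e ≤ |x| * e := by
        have := hA.mul_nonneg _ _ (sub_nonneg.2 (le_abs_self x)) he
        rwa [sub_mul, sub_nonneg] at this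
      have h2 : -(e * x) ≤ e * |x| := by
        have := hA.mul_nonneg _ _ he (sub_nonneg.2 (neg_le_abs x))
        rwa [mul_sub, sub_nonneg, mul_neg] at this
      rw [hTa, sub_eq_add_neg, add_comm]
      exact add_le_add h2 h1
    intro x
    refine abs_le'.2 ⟨h1 x, ?_⟩
    have := h1 (-x)
    rw [abs_neg] at this
    refine le_trans (le_of_eq ?_) this
    noncomm_ring
  have main : ∀ n : ℕ, n • |f * e - e * f| ≤ T e := by
    intro n
    rw [← abs_nsmul_eq]
    refine le_map_step_of_forall_le_map_abs T hTinf he (fun k => n • f - k • e) n ?_ ?_ ?_ ?_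
    · simpa using nsmul_nonneg hf n
    · exact sub_nonpos.2 (nsmul_le_nsmul_right hfe n)
    · intro k; simp only [succ_nsmul]; abel
    · intro k _
      refine le_trans (le_of_eq ?_) (habs _)
      congr 1
      simp only [sub_mul, mul_sub, smul_mul_assoc, mul_smul_comm, smul_sub]
      abel
  exact sub_eq_zero.1 (eq_zero_of_abs_eq_zero (harch _ _ (abs_nonneg _) main))

theorem IsFAlgebra.mul_comm (hA : IsFAlgebra A) (harch : IsArchimedeanLattice A) (a b : A) :
    a * b = b * a := by
  have hpos : ∀ a b : A, 0 ≤ a → 0 ≤ b → a * b = b * a := by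
    intro a b ha hb
    -- Commuting with `a + b` is the same as commuting with `b`, since `a` commutes with itself.
    have := hA.mul_comm_of_le harch ha (le_add_of_nonneg_right hb)
    rwa [mul_add, add_mul, add_right_inj] at this
  rw [← posPart_sub_negPart a, ← posPart_sub_negPart b]
  simp only [mul_sub, sub_mul]
  rw [hpos _ _ (posPart_nonneg a) (posPart_nonneg b), hpos _ _ (posPart_nonneg a) (negPart_nonneg b),
    hpos _ _ (negPart_nonneg a) (posPart_nonneg b), hpos _ _ (negPart_nonneg a) (negPart_nonneg b)]
  abel

end Commutativity

/-! ### Powers of positive elements and the lattice operations -/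

section Powers

/-- The power `a ^ (n + 1)` in an algebra that need not have a unit. -/
def succPow {A : Type*} [Mul A] : ℕ → A → A
  | 0, a => a
  | n + 1, a => succPow n a * a

theorem succPow_succ {A : Type*} [Mul A] (n : ℕ) (a : A) : succPow (n + 1) a = succPow n a * a :=
  rfl

/-- The cofactor `s` in `a ^ (m + 2) - b ^ (m + 2) = (a - b) * s`. -/
def powSubCofactor {A : Type*} [NonUnitalRing A] : ℕ → A → A → A
  | 0, a, b => a + b
  | m + 1, a, b => succPow (m + 1) a + powSubCofactor m a b * b

theorem foldProd_const {A : Type*} [NonUnitalRing A] (n : ℕ) (a : A) :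
    foldProd (n + 1) (fun _ => a) = succPow n a := by
  induction n with
  | zero => rfl
  | succ n ih => rw [foldProd, ih, succPow]

variable {A : Type*} [NonUnitalCommRing A]

theorem succPow_mul (n : ℕ) (a b : A) : succPow n (a * b) = succPow n a * succPow n b := by
  induction n with
  | zero => rfl
  | succ n ih => simp only [succPow, ih]; exact mul_mul_mul_comm _ _ _ _

theorem succPow_smul [Module ℝ A] [IsScalarTower ℝ A A] [SMulCommClass ℝ A A] (n : ℕ) (c : ℝ)
    (a : A) : succPow n (c • a) = c ^ (n + 1) • succPow n a := by
  induction n with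
  | zero => simp [succPow]
  | succ n ih => rw [succPow, ih, succPow, smul_mul_smul_comm, ← pow_succ]

theorem succPow_sub_succPow (m : ℕ) (a b : A) :
    succPow (m + 1) a - succPow (m + 1) b = (a - b) * powSubCofactor m a b := by
  induction m with
  | zero =>
    simp only [succPow, powSubCofactor, sub_mul, mul_add, mul_comm b a]
    abel
  | succ m ih =>
    rw [succPow_succ (m + 1) a, succPow_succ (m + 1) b, powSubCofactor, mul_add, ← mul_assoc, ← ih,
      sub_mul, sub_mul, mul_comm a, mul_comm b]
    abel

variable [Lattice A]

theorem IsFAlgebra.disjoint_mul_mul (hA : IsFAlgebra A) {a b s t : A} (h : a ⊓ b = 0) (hs : 0 ≤ s)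
    (ht : 0 ≤ t) : (a * s) ⊓ (b * t) = 0 := by
  have h1 := hA.mul_right_disjoint a b s h hs
  rw [inf_comm] at h1 ⊢
  exact hA.mul_right_disjoint _ _ t h1 ht

theorem IsFAlgebra.mul_eq_zero_of_disjoint (hA : IsFAlgebra A) {a b : A} (h : a ⊓ b = 0) :
    a * b = 0 := by
  have := hA.disjoint_mul_mul h (h ▸ inf_le_right : 0 ≤ b) (h ▸ inf_le_left : 0 ≤ a)
  rwa [_root_.mul_comm b a, inf_idem] at this

variable [IsOrderedAddMonoid A]

theorem IsFAlgebra.posMulMono (hA : IsFAlgebra A) : PosMulMono A where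
  mul_le_mul_of_nonneg_left a ha b c h := by
    have := hA.mul_nonneg _ _ ha (sub_nonneg.2 h)
    rwa [mul_sub, sub_nonneg] at this

theorem IsFAlgebra.mulPosMono (hA : IsFAlgebra A) : MulPosMono A where
  mul_le_mul_of_nonneg_right a ha b c h := by
    have := hA.mul_nonneg _ _ (sub_nonneg.2 h) ha
    rwa [sub_mul, sub_nonneg] at this

/-- Multiplication by a positive element preserves binary infima. -/
theorem IsFAlgebra.inf_mul (hA : IsFAlgebra A) {s : A} (hs : 0 ≤ s) (a b : A) :
    (a ⊓ b) * s = (a * s) ⊓ (b * s) :=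
  (AddMonoidHom.mulRight s).map_inf_of_disjoint (fun _ _ h => hA.disjoint_mul_mul h hs hs) a b

variable [PosMulMono A] [MulPosMono A]

theorem abs_mul_le_abs_mul {s : A} (hs : 0 ≤ s) (a : A) : |a * s| ≤ |a| * s :=
  abs_le'.2 ⟨mul_le_mul_of_nonneg_right (le_abs_self a) hs, by
    rw [← neg_mul]; exact mul_le_mul_of_nonneg_right (neg_le_abs a) hs⟩

theorem abs_mul_le_mul_abs (a b : A) : |a * b| ≤ |a| * |b| := by
  have h1 : ∀ a b : A, a * b ≤ |a| * |b| := by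
    intro a b
    have h1 := mul_nonneg (sub_nonneg.2 (le_abs_self a)) (sub_nonneg.2 (neg_le_abs b))
    have h2 := mul_nonneg (sub_nonneg.2 (neg_le_abs a)) (sub_nonneg.2 (le_abs_self b))
    rw [← sub_nonneg]
    refine nsmul_two_semiclosed ((add_nonneg h1 h2).trans (le_of_eq ?_))
    simp only [mul_sub, sub_mul, mul_neg, neg_mul, two_nsmul]
    abel
  exact abs_le'.2 ⟨h1 a b, by rw [← neg_mul]; simpa using h1 (-a) b⟩

theorem succPow_nonneg (n : ℕ) {a : A} (ha : 0 ≤ a) : 0 ≤ succPow n a := by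
  induction n with
  | zero => exact ha
  | succ n ih => exact mul_nonneg ih ha

theorem succPow_le_succPow (n : ℕ) {a b : A} (ha : 0 ≤ a) (hab : a ≤ b) :
    succPow n a ≤ succPow n b := by
  induction n with
  | zero => exact hab
  | succ n ih => exact mul_le_mul ih hab ha (succPow_nonneg n (ha.trans hab))

theorem succPow_add_succPow_le (n : ℕ) {a b : A} (ha : 0 ≤ a) (hb : 0 ≤ b) :
    succPow n a + succPow n b ≤ succPow n (a + b) := by
  induction n with
  | zero => exact le_rfl
  | succ n ih =>
    refine le_trans ?_ (mul_le_mul_of_nonneg_right ih (add_nonneg ha hb))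
    rw [succPow, succPow, add_mul, mul_add, mul_add]
    exact add_le_add (le_add_of_nonneg_right (mul_nonneg (succPow_nonneg n ha) hb))
      (le_add_of_nonneg_left (mul_nonneg (succPow_nonneg n hb) ha))

theorem powSubCofactor_nonneg (m : ℕ) {a b : A} (ha : 0 ≤ a) (hb : 0 ≤ b) :
    0 ≤ powSubCofactor m a b := by
  induction m with
  | zero => exact add_nonneg ha hb
  | succ m ih => exact add_nonneg (succPow_nonneg _ ha) (mul_nonneg ih hb)

theorem succPow_le_powSubCofactor (m : ℕ) {a b : A} (ha : 0 ≤ a) (hb : 0 ≤ b) :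
    succPow m a ≤ powSubCofactor m a b := by
  cases m with
  | zero => exact le_add_of_nonneg_right hb
  | succ m => exact le_add_of_nonneg_right (mul_nonneg (powSubCofactor_nonneg m ha hb) hb)

theorem powSubCofactor_le (m : ℕ) {a b c : A} (ha : 0 ≤ a) (hb : 0 ≤ b) (hac : a ≤ c)
    (hbc : b ≤ c) : powSubCofactor m a b ≤ (m + 2) • succPow m c := by
  induction m with
  | zero => rw [zero_add, two_nsmul]; exact add_le_add hac hbc
  | succ m ih =>
    rw [powSubCofactor, add_right_comm, succ_nsmul', succPow, succPow, ← smul_mul_assoc]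
    exact add_le_add (succPow_le_succPow (m + 1) ha hac) (mul_le_mul ih hbc hb
      (nsmul_nonneg (succPow_nonneg m (ha.trans hac)) _))

/-- The factor `g ≤ c` raises the degree by one, so that the estimate also covers first powers, for
which no unit is available as a cofactor. -/
theorem abs_succPow_sub_mul_le (n : ℕ) {a b c g : A} (ha : 0 ≤ a) (hb : 0 ≤ b) (hac : a ≤ c)
    (hbc : b ≤ c) (hg : 0 ≤ g) (hgc : g ≤ c) :
    |(succPow n a - succPow n b) * g| ≤ (n + 1) • (|a - b| * succPow n c) := by
  have hc := ha.trans hac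
  cases n with
  | zero =>
    rw [zero_add, one_nsmul]
    exact (abs_mul_le_abs_mul hg _).trans (mul_le_mul_of_nonneg_left hgc (abs_nonneg _))
  | succ m =>
    rw [succPow_sub_succPow, mul_assoc]
    refine (abs_mul_le_abs_mul (mul_nonneg (powSubCofactor_nonneg m ha hb) hg) _).trans ?_
    rw [← mul_smul_comm, succPow, ← smul_mul_assoc]
    exact mul_le_mul_of_nonneg_left (mul_le_mul (powSubCofactor_le m ha hb hac hbc) hgc hg
      (nsmul_nonneg (succPow_nonneg m hc) _)) (abs_nonneg _)

theorem abs_succPow_sub_le (m : ℕ) {a b c : A} (ha : 0 ≤ a) (hb : 0 ≤ b) (hac : a ≤ c)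
    (hbc : b ≤ c) :
    |succPow (m + 1) a - succPow (m + 1) b| ≤ (m + 2) • (|a - b| * succPow m c) := by
  rw [succPow_sub_succPow]
  refine (abs_mul_le_abs_mul (powSubCofactor_nonneg m ha hb) _).trans ?_
  rw [← mul_smul_comm]
  exact mul_le_mul_of_nonneg_left (powSubCofactor_le m ha hb hac hbc) (abs_nonneg _)

/-- The elements `a - a ⊓ b` and `b - a ⊓ b` are disjoint and stay so after multiplication by
positive cofactors; these products are the differences of the powers. -/
theorem IsFAlgebra.succPow_inf (hA : IsFAlgebra A) (n : ℕ) {a b : A} (ha : 0 ≤ a) (hb : 0 ≤ b) :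
    succPow n (a ⊓ b) = succPow n a ⊓ succPow n b := by
  cases n with
  | zero => rfl
  | succ m =>
    have hm := le_inf ha hb
    have h := hA.disjoint_mul_mul (sub_inf_inf_sub_inf a b) (powSubCofactor_nonneg m ha hm)
      (powSubCofactor_nonneg m hb hm)
    rw [← succPow_sub_succPow, ← succPow_sub_succPow, ← inf_sub, sub_eq_zero] at h
    exact h.symm

theorem IsFAlgebra.succPow_sup (hA : IsFAlgebra A) (n : ℕ) {a b : A} (ha : 0 ≤ a) (hb : 0 ≤ b) :
    succPow n (a ⊔ b) = succPow n a ⊔ succPow n b := by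
  cases n with
  | zero => rfl
  | succ m =>
    have hm := ha.trans (le_sup_left (b := b))
    have h := hA.disjoint_mul_mul (sup_sub_inf_sup_sub a b) (powSubCofactor_nonneg m hm ha)
      (powSubCofactor_nonneg m hm hb)
    rw [← succPow_sub_succPow, ← succPow_sub_succPow, ← sub_sup, sub_eq_zero] at h
    exact h

/-- As `|a - b|` is supremum minus infimum, this is superadditivity of powers. It turns closeness of
powers into closeness of roots. -/
theorem IsFAlgebra.succPow_abs_sub_le (hA : IsFAlgebra A) (n : ℕ) {a b : A} (ha : 0 ≤ a)
    (hb : 0 ≤ b) : succPow n |a - b| ≤ |succPow n a - succPow n b| := by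
  rw [← sup_sub_inf_eq_abs_sub, ← sup_sub_inf_eq_abs_sub, ← hA.succPow_sup n hb ha,
    ← hA.succPow_inf n hb ha, le_sub_iff_add_le]
  have := succPow_add_succPow_le n (sub_nonneg.2 (inf_le_sup (a := b) (b := a))) (le_inf hb ha)
  rwa [sub_add_cancel] at this

/-- With `c = (a - b)⁺` one has `c * (a - b) = c * c`. Multiplying the factored difference of powers
by `c`, and bounding the cofactor below by a power of `c`, makes a power of `c` vanish. -/
theorem IsSemiprimeAlgebra.le_of_succPow_le (hs : IsSemiprimeAlgebra A) (hA : IsFAlgebra A)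
    (n : ℕ) {a b : A} (ha : 0 ≤ a) (hb : 0 ≤ b) (h : succPow n a ≤ succPow n b) : a ≤ b := by
  cases n with
  | zero => exact h
  | succ m =>
    rw [← sub_nonpos, succPow_sub_succPow] at h
    have hc0 := posPart_nonneg (a - b)
    have hmul : (a - b)⁺ * (a - b) = (a - b)⁺ * (a - b)⁺ := by
      nth_rewrite 2 [← posPart_sub_negPart (a - b)]
      rw [mul_sub, hA.mul_eq_zero_of_disjoint (posPart_inf_negPart_eq_zero _), sub_zero]
    have hca : (a - b)⁺ ≤ a := sup_le (sub_le_self a hb) ha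
    have h1 := mul_le_mul_of_nonneg_left h hc0
    rw [← mul_assoc, hmul, mul_zero] at h1
    have h2 : (a - b)⁺ * (a - b)⁺ * succPow m (a - b)⁺ ≤ 0 :=
      (mul_le_mul_of_nonneg_left ((succPow_le_succPow m hc0 hca).trans
        (succPow_le_powSubCofactor m ha hb)) (mul_nonneg hc0 hc0)).trans h1
    have h3 : succPow (m + 2) (a - b)⁺ = 0 := by
      refine le_antisymm (le_trans (le_of_eq ?_) h2) (succPow_nonneg _ hc0)
      rw [succPow, succPow, mul_assoc, mul_comm]
    have h4 := hs _ ⟨m + 3, by omega, (foldProd_const (m + 2) _).trans h3⟩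
    exact sub_nonpos.1 (h4 ▸ le_posPart (a - b))

end Powers

/-! ### Existence of roots -/

section Roots

variable {A : Type*} [NonUnitalCommRing A] [Lattice A] [IsOrderedAddMonoid A] [Module ℝ A]
  [PosSMulMono ℝ A] [IsScalarTower ℝ A A] [SMulCommClass ℝ A A] [PosMulMono A] [MulPosMono A]

/-- Approximate roots converge to a root in a uniformly complete algebra. -/
theorem exists_succPow_eq_of_forall_approx (hA : IsFAlgebra A) (harch : IsArchimedeanLattice A)
    (hcomplete : IsUniformlyComplete A) (hs : IsSemiprimeAlgebra A) (m : ℕ) {e y : A} (he : 0 ≤ e)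
    (h : ∀ ε : ℝ, 0 < ε → ∃ w, 0 ≤ w ∧ |succPow (m + 1) w - y| ≤ ε • succPow (m + 1) e) :
    ∃ w, 0 ≤ w ∧ succPow (m + 1) w = y := by
  have hδ (k : ℕ) : (0 : ℝ) < 1 / ((k : ℝ) + 1) := by positivity
  -- The tolerance is a power of matching degree, so that taking roots leaves distances linear in `1
  -- / (k + 1)`.
  choose w hw0 hw using fun k : ℕ => h ((1 / ((k : ℝ) + 1)) ^ (m + 2)) (pow_pos (hδ k) _)
  have hdist (j k : ℕ) : |w j - w k| ≤ (1 / ((j : ℝ) + 1) + 1 / ((k : ℝ) + 1)) • e := by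
    refine hs.le_of_succPow_le hA (m + 1) (abs_nonneg _)
      (smul_nonneg (add_pos (hδ j) (hδ k)).le he) ?_
    refine (hA.succPow_abs_sub_le (m + 1) (hw0 j) (hw0 k)).trans ?_
    have h1 := abs_add_le (succPow (m + 1) (w j) - y) (y - succPow (m + 1) (w k))
    rw [sub_add_sub_cancel, abs_sub_comm y] at h1
    refine h1.trans ((add_le_add (hw j) (hw k)).trans ?_)
    rw [← succPow_smul, ← succPow_smul, add_smul]
    exact succPow_add_succPow_le _ (smul_nonneg (hδ j).le he) (smul_nonneg (hδ k).le he)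
  obtain ⟨g, hg⟩ := hcomplete e he w fun ε hε => by
    obtain ⟨N, hN⟩ := exists_nat_one_div_lt (half_pos hε)
    refine ⟨N, fun i hi j hj => (hdist i j).trans (smul_le_smul_of_nonneg_right ?_ he)⟩
    have := Nat.one_div_le_one_div (α := ℝ) hi
    have := Nat.one_div_le_one_div (α := ℝ) hj
    linarith
  have hg0 := posPart_nonneg g
  -- Of the constant `m + 3`, a share `m + 2` pays for replacing `w n` by `g⁺` inside the power and
  -- `1` for the error of `w n` as an approximate root.
  refine ⟨g⁺, hg0, sub_eq_zero.1 (harch.eq_zero_of_forall_abs_le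
    (y := ((m : ℝ) + 3) • succPow (m + 1) (g⁺ + e)) fun ε hε => ?_)⟩
  obtain ⟨N, hN⟩ := hg (min ε 1) (lt_min hε one_pos)
  obtain ⟨K, hK⟩ := exists_nat_one_div_lt hε
  obtain ⟨n, hnN, hnK⟩ : ∃ n, N ≤ n ∧ K ≤ n := ⟨max N K, le_max_left _ _, le_max_right _ _⟩
  have hc0 : 0 ≤ g⁺ + e := add_nonneg hg0 he
  have hec : e ≤ g⁺ + e := le_add_of_nonneg_left hg0
  have hn : |w n - g⁺| ≤ min ε 1 • e := by
    refine le_trans ?_ (hN n hnN)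
    have := abs_sup_sub_sup_le_abs (w n) g 0
    rwa [sup_eq_left.2 (hw0 n)] at this
  have hn1 : |w n - g⁺| ≤ ε • (g⁺ + e) := hn.trans
    ((smul_le_smul_of_nonneg_right (min_le_left _ _) he).trans
      (smul_le_smul_of_nonneg_left hec hε.le))
  have hnc : w n ≤ g⁺ + e := by
    have := (le_abs_self _).trans (hn.trans (smul_le_smul_of_nonneg_right (min_le_right _ _) he))
    rwa [one_smul, sub_le_iff_le_add, add_comm] at this
  have h1 : |succPow (m + 1) g⁺ - succPow (m + 1) (w n)|
      ≤ (ε * ((m : ℝ) + 2)) • succPow (m + 1) (g⁺ + e) := by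
    refine (abs_succPow_sub_le m hg0 (hw0 n) (le_add_of_nonneg_right he) hnc).trans ?_
    rw [← Nat.cast_smul_eq_nsmul ℝ, abs_sub_comm, mul_comm ε, mul_smul, succPow]
    push_cast
    refine smul_le_smul_of_nonneg_left ?_ (by positivity)
    rw [mul_comm (succPow m _), ← smul_mul_assoc]
    exact mul_le_mul_of_nonneg_right hn1 (succPow_nonneg m hc0)
  have h2 : |succPow (m + 1) (w n) - y| ≤ ε • succPow (m + 1) (g⁺ + e) := by
    refine (hw n).trans ((smul_le_smul_of_nonneg_right ?_ (succPow_nonneg _ he)).trans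
      (smul_le_smul_of_nonneg_left (succPow_le_succPow _ he hec) hε.le))
    have h3 := Nat.one_div_le_one_div (α := ℝ) hnK
    refine (pow_le_of_le_one (hδ n).le ?_ (by omega)).trans (h3.trans hK.le)
    simpa using Nat.one_div_le_one_div (α := ℝ) (Nat.zero_le n)
  have h3 := abs_add_le (succPow (m + 1) g⁺ - succPow (m + 1) (w n)) (succPow (m + 1) (w n) - y)
  rw [sub_add_sub_cancel] at h3
  refine h3.trans ((add_le_add h1 h2).trans (le_of_eq ?_))
  rw [← add_smul, smul_smul]
  congr 1
  ring

/-- Roots of elements that are close to `q t • e ^ (m + 2)` wherever `f` is close to `t • e`. -/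
theorem exists_succPow_eq_of_lipschitz (hA : IsFAlgebra A) (harch : IsArchimedeanLattice A)
    (hcomplete : IsUniformlyComplete A) (hs : IsSemiprimeAlgebra A) (m : ℕ) {e f y : A}
    (hf : 0 ≤ f) (hfe : f ≤ e) (hy0 : 0 ≤ y) (q : ℝ → ℝ) (hq0 : ∀ t, 0 ≤ t → t ≤ 1 → 0 ≤ q t)
    (hq1 : ∀ t, 0 ≤ t → t ≤ 1 → q t ≤ 1) {C : ℝ} (hC : 0 < C)
    (h : ∀ t, 0 ≤ t → t ≤ 1 →
      |y - q t • succPow (m + 1) e| ≤ C • (|f - t • e| * succPow m e)) :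
    ∃ w, 0 ≤ w ∧ succPow (m + 1) w = y := by
  have he := hf.trans hfe
  have hem := succPow_nonneg m he
  refine exists_succPow_eq_of_forall_approx hA harch hcomplete hs m he fun ε hε => ?_
  -- This choice gives `C • d * e ^ (m + 1) - ε • e ^ (m + 2) = (M • d - e) * (ε • e ^ (m + 1))`.
  obtain ⟨M, hM, hMC⟩ : ∃ M : ℝ, 0 < M ∧ ε * M = C := ⟨C / ε, by positivity, by field_simp⟩
  have hterm : ∀ t : ℝ, 0 ≤ t → t ≤ 1 → ∃ v, 0 ≤ v ∧ succPow (m + 1) v ≤ y + ε • succPow (m + 1) e ∧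
      y - succPow (m + 1) v ≤ (C + (m + 2) * M) • (|f - t • e| * succPow m e) := by
    intro t ht0 ht1
    obtain ⟨r, hr0, hr1, hrq⟩ : ∃ r : ℝ, 0 ≤ r ∧ r ≤ 1 ∧ r ^ (m + 2) = q t :=
      ⟨q t ^ (((m + 2 : ℕ) : ℝ)⁻¹), Real.rpow_nonneg (hq0 t ht0 ht1) _,
        Real.rpow_le_one (hq0 t ht0 ht1) (hq1 t ht0 ht1) (by positivity),
        Real.rpow_inv_natCast_pow (hq0 t ht0 ht1) (by omega)⟩
    have hy := h t ht0 ht1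
    rw [← hrq, ← succPow_smul] at hy
    have hre : r • e ≤ e := by simpa using smul_le_smul_of_nonneg_right hr1 he
    have hre0 : 0 ≤ r • e := smul_nonneg hr0 he
    generalize hd : |f - t • e| = d at hy ⊢
    have hd0 : 0 ≤ d := hd ▸ abs_nonneg _
    have hMd : 0 ≤ M • d := smul_nonneg hM.le hd0
    have hv0 := posPart_nonneg (r • e - M • d)
    have hvr : (r • e - M • d)⁺ ≤ r • e := sup_le (sub_le_self _ hMd) hre0
    -- A spike of the right height `r • e` where `f = t • e`, cut off in proportion to the distance
    -- `d` so that it never exceeds the root by much.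
    refine ⟨(r • e - M • d)⁺, hv0, ?_, ?_⟩
    · set v := (r • e - M • d)⁺ with hv
      set z := M • d - e with hz
      have hvz : v ≤ z⁻ := by
        refine sup_le ?_ (negPart_nonneg z)
        refine le_trans ?_ (neg_le_negPart z)
        rw [hz, neg_sub]
        exact sub_le_sub_right hre _
      have hdis := hA.disjoint_mul_mul (posPart_inf_negPart_eq_zero z)
        (smul_nonneg hε.le hem) (succPow_nonneg m hv0)
      -- The excess of the power of `v` is below a multiple of `z⁺`, by the Lipschitz bound, and
      -- below a multiple of `z⁻`, since `v ≤ z⁻`. These are disjoint, so the excess is at most `0`.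
      rw [← sub_nonpos, ← hdis]
      refine le_inf ?_ ?_
      · have h1 := succPow_le_succPow (m + 1) hv0 hvr
        have h2 := (neg_le_abs _).trans hy
        rw [neg_sub, sub_le_iff_le_add] at h2
        have h3 : z * (ε • succPow m e) ≤ z⁺ * (ε • succPow m e) :=
          mul_le_mul_of_nonneg_right (le_posPart z) (smul_nonneg hε.le hem)
        refine le_trans (le_trans (sub_le_sub_right (h1.trans h2) _) (le_of_eq ?_)) h3
        rw [hz, sub_mul, mul_smul_comm, mul_smul_comm, smul_mul_assoc, smul_smul, hMC, succPow,
          mul_comm e]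
        abel
      · refine (sub_le_self _ (add_nonneg hy0 (smul_nonneg hε.le (succPow_nonneg _ he)))).trans ?_
        rw [succPow, mul_comm]
        exact mul_le_mul_of_nonneg_right hvz (succPow_nonneg m hv0)
    · have h1 := abs_succPow_sub_le m hre0 hv0 hre (hvr.trans hre)
      have h2 : |r • e - (r • e - M • d)⁺| ≤ M • d := by
        rw [abs_of_nonneg (sub_nonneg.2 hvr), sub_le_comm]
        exact le_posPart _
      have h3 := (le_abs_self _).trans (h1.trans (nsmul_le_nsmul_right
        (mul_le_mul_of_nonneg_right h2 hem) _))
      have h4 := add_le_add ((le_abs_self _).trans hy) h3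
      rw [sub_add_sub_cancel] at h4
      refine h4.trans (le_of_eq ?_)
      rw [← Nat.cast_smul_eq_nsmul ℝ, smul_mul_assoc, smul_smul, ← add_smul]
      push_cast
      rfl
  obtain ⟨N, hN⟩ := exists_nat_gt ((C + (m + 2) * M) / ε)
  have hK : 0 < C + (m + 2) * M := by positivity
  have hN0 : (0 : ℝ) < N := lt_trans (by positivity) hN
  have hkN : ∀ k : ℕ, k ≤ N → 0 ≤ (k : ℝ) / N ∧ (k : ℝ) / N ≤ 1 := fun k hk =>
    ⟨by positivity, (div_le_one hN0).2 (by exact_mod_cast hk)⟩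
  -- Powers preserve suprema, so the supremum of the spikes keeps their common upper bound and
  -- inherits the lower estimate of each.
  have hsup : ∀ n ≤ N, ∃ w, 0 ≤ w ∧ succPow (m + 1) w ≤ y + ε • succPow (m + 1) e ∧
      ∀ k ≤ n, y - succPow (m + 1) w ≤
        (C + (m + 2) * M) • (|f - ((k : ℝ) / N) • e| * succPow m e) := by
    intro n
    induction n with
    | zero =>
      intro hn
      obtain ⟨v, hv0, hv1, hv2⟩ := hterm _ (hkN 0 hn).1 (hkN 0 hn).2
      exact ⟨v, hv0, hv1, fun k hk => by rw [Nat.le_zero.1 hk]; exact hv2⟩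
    | succ n ih =>
      intro hn
      obtain ⟨v, hv0, hv1, hv2⟩ := hterm _ (hkN _ hn).1 (hkN _ hn).2
      obtain ⟨w, hw0, hw1, hw2⟩ := ih (by omega)
      refine ⟨w ⊔ v, hw0.trans le_sup_left, ?_, fun k hk => ?_⟩
      · rw [hA.succPow_sup _ hw0 hv0]
        exact sup_le hw1 hv1
      · rw [hA.succPow_sup _ hw0 hv0]
        rcases Nat.le_succ_iff.1 hk with hk | rfl
        · exact (sub_le_sub_left le_sup_left _).trans (hw2 k hk)
        · exact (sub_le_sub_left le_sup_right _).trans hv2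
  obtain ⟨w, hw0, hw1, hw2⟩ := hsup N le_rfl
  refine ⟨w, hw0, abs_le'.2 ⟨by rwa [sub_le_iff_le_add'], ?_⟩⟩
  rw [neg_sub]
  have hKN : 0 < (C + (m + 2) * M) / N := by positivity
  -- The estimates at the nodes `k / N`, rescaled by `N`, involve the progression `N • f - k • e`;
  -- its step `e` leaves an error of order `1 / N`.
  have key : y - succPow (m + 1) w ≤ ((C + (m + 2) * M) / N) • (e * succPow m e) := by
    refine le_map_step_of_forall_le_map_abs
      (fun x : A => ((C + (m + 2) * M) / N) • (x * succPow m e)) (fun a b => ?_) he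
      (fun k => N • f - k • e) N ?_ ?_ ?_ ?_
    · rw [hA.inf_mul hem, smul_inf_of_pos hKN]
    · simpa using nsmul_nonneg hf N
    · exact sub_nonpos.2 (nsmul_le_nsmul_right hfe N)
    · intro k; simp only [succ_nsmul]; abel
    · intro k hk
      refine (hw2 k hk).trans (le_of_eq ?_)
      have : N • f - k • e = (N : ℝ) • (f - ((k : ℝ) / N) • e) := by
        rw [smul_sub, smul_smul, mul_div_cancel₀ _ hN0.ne', Nat.cast_smul_eq_nsmul,
          Nat.cast_smul_eq_nsmul]
      change _ = _ • (|N • f - k • e| * _)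
      rw [this, abs_smul_of_nonneg hN0.le, smul_mul_assoc, smul_smul, div_mul_cancel₀ _ hN0.ne']
  rw [mul_comm e, ← succPow_succ] at key
  refine key.trans (smul_le_smul_of_nonneg_right ?_ (succPow_nonneg (m + 1) he))
  rw [div_le_iff₀ hN0, mul_comm ε]
  exact ((div_lt_iff₀ hε).1 hN).le

theorem exists_succPow_eq_sub (hA : IsFAlgebra A) (harch : IsArchimedeanLattice A)
    (hcomplete : IsUniformlyComplete A) (hs : IsSemiprimeAlgebra A) (n : ℕ) {a b : A}
    (hb : 0 ≤ b) (hba : b ≤ a) : ∃ w, 0 ≤ w ∧ succPow n w = succPow n a - succPow n b := by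
  cases n with
  | zero => exact ⟨a - b, sub_nonneg.2 hba, rfl⟩
  | succ m =>
    have ha := hb.trans hba
    -- Here `e = a` and `f = b`.
    refine exists_succPow_eq_of_lipschitz hA harch hcomplete hs m hb hba
      (sub_nonneg.2 (succPow_le_succPow _ hb hba)) (fun t => 1 - t ^ (m + 2))
      (fun t h0 h1 => sub_nonneg.2 (pow_le_one₀ h0 h1))
      (fun t h0 h1 => sub_le_self _ (pow_nonneg h0 _)) (C := (m + 2 : ℕ)) (by positivity)
      fun t h0 h1 => ?_
    have hta : t • a ≤ a := by simpa using smul_le_smul_of_nonneg_right h1 ha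
    have := abs_succPow_sub_le m hb (smul_nonneg h0 ha) hba hta
    rw [succPow_smul, abs_sub_comm] at this
    rw [Nat.cast_smul_eq_nsmul, sub_smul, one_smul, sub_sub_sub_cancel_left]
    exact this

theorem exists_succPow_eq_mul (hA : IsFAlgebra A) (harch : IsArchimedeanLattice A)
    (hcomplete : IsUniformlyComplete A) (hs : IsSemiprimeAlgebra A) (n : ℕ) {a b : A}
    (ha : 0 ≤ a) (hb : 0 ≤ b) : ∃ w, 0 ≤ w ∧ succPow (n + 1) w = succPow n a * b := by
  have hab : 0 ≤ a + b := add_nonneg ha hb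
  have hae : a ≤ a + b := le_add_of_nonneg_right hb
  have hbe : b ≤ a + b := le_add_of_nonneg_left ha
  -- Here `e = a + b` and `f = a`, so `f = t • e` corresponds to `b = (1 - t) • e`. The Lipschitz
  -- constant is `n + 1` for varying the power of `a` plus `1` for varying `b`.
  refine exists_succPow_eq_of_lipschitz hA harch hcomplete hs n ha hae
    (mul_nonneg (succPow_nonneg n ha) hb) (fun t => t ^ (n + 1) * (1 - t))
    (fun t h0 h1 => mul_nonneg (pow_nonneg h0 _) (sub_nonneg.2 h1))
    (fun t h0 h1 => mul_le_one₀ (pow_le_one₀ h0 h1) (sub_nonneg.2 h1) (sub_le_self _ h0))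
    (C := (n + 1 + 1 : ℕ)) (by positivity) fun t h0 h1 => ?_
  have hte : t • (a + b) ≤ a + b := by simpa using smul_le_smul_of_nonneg_right h1 hab
  have hte0 : 0 ≤ t • (a + b) := smul_nonneg h0 hab
  have h2 := abs_succPow_sub_mul_le n ha hte0 hae hte hb hbe
  have h3 : |(t • (a + b) - a) * succPow n (t • (a + b))|
      ≤ |a - t • (a + b)| * succPow n (a + b) := by
    refine (abs_mul_le_abs_mul (succPow_nonneg n hte0) _).trans ?_
    rw [abs_sub_comm]
    exact mul_le_mul_of_nonneg_left (succPow_le_succPow n hte0 hte) (abs_nonneg _)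
  have h4 := (abs_add_le _ _).trans (add_le_add h2 h3)
  rw [Nat.cast_smul_eq_nsmul, succ_nsmul]
  refine le_trans (le_of_eq ?_) h4
  congr 1
  have h5 : t • (a + b) - a = b - (1 - t) • (a + b) := by
    rw [sub_smul, one_smul]; abel
  rw [h5, sub_mul, sub_mul, mul_comm b (succPow n (t • (a + b))), sub_add_sub_cancel, succPow_succ,
    succPow_smul, smul_mul_smul_comm, mul_comm (1 - t), mul_comm (a + b)]

/-- Sums reduce to differences: subtract the powers of `a` and of `b` from that of `a + b`, then
subtract the result from the power of `a + b`. Superadditivity keeps each difference positive. -/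
theorem exists_succPow_eq_add (hA : IsFAlgebra A) (harch : IsArchimedeanLattice A)
    (hcomplete : IsUniformlyComplete A) (hs : IsSemiprimeAlgebra A) (n : ℕ) {a b : A}
    (ha : 0 ≤ a) (hb : 0 ≤ b) : ∃ w, 0 ≤ w ∧ succPow n w = succPow n a + succPow n b := by
  have hroot {x y : A} (hy : 0 ≤ y) (hyx : y ≤ x) :=
    exists_succPow_eq_sub hA harch hcomplete hs n hy hyx
  have hab := succPow_add_succPow_le n ha hb
  have haw : a ≤ a + b := le_add_of_nonneg_right hb
  obtain ⟨r, hr0, hr⟩ := hroot ha haw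
  have hbr : b ≤ r := hs.le_of_succPow_le hA n hb hr0 (by rwa [hr, le_sub_iff_add_le'])
  obtain ⟨s, hs0, hs1⟩ := hroot hb hbr
  have hsw : s ≤ a + b := hs.le_of_succPow_le hA n hs0 (add_nonneg ha hb) (by
    rw [hs1, hr, sub_sub]
    exact sub_le_self _ (add_nonneg (succPow_nonneg n ha) (succPow_nonneg n hb)))
  obtain ⟨w, hw0, hw⟩ := hroot hs0 hsw
  refine ⟨w, hw0, ?_⟩
  rw [hw, hs1, hr]
  abel

end Roots

/-! ### The three classes of finite elements as ideals -/

section FiniteElements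

variable {V : Type*} [AddCommGroup V] [Lattice V] [IsOrderedAddMonoid V] [Module ℝ V]
  [PosSMulMono ℝ V]

theorem IsMajorant.of_abs_le {z φ ψ : V} (h : IsMajorant z φ) (hψ : |ψ| ≤ |φ|) :
    IsMajorant z ψ := by
  refine ⟨h.1, fun x => ?_⟩
  obtain ⟨c, hc, hx⟩ := h.2 x
  exact ⟨c, hc, fun n => (inf_le_inf_left _ (nsmul_le_nsmul_right hψ n)).trans (hx n)⟩

theorem IsMajorant.of_le {z z' φ : V} (h : IsMajorant z φ) (hz : z ≤ z') : IsMajorant z' φ := by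
  refine ⟨h.1.trans hz, fun x => ?_⟩
  obtain ⟨c, hc, hx⟩ := h.2 x
  exact ⟨c, hc, fun n => (hx n).trans (smul_le_smul_of_nonneg_left hz hc.le)⟩

theorem IsMajorant.add {y z φ ψ : V} (hφ : IsMajorant y φ) (hψ : IsMajorant z ψ) :
    IsMajorant (y + z) (φ + ψ) := by
  refine ⟨add_nonneg hφ.1 hψ.1, fun x => ?_⟩
  obtain ⟨c, hc, hcx⟩ := hφ.2 x
  obtain ⟨d, hd, hdx⟩ := hψ.2 x
  refine ⟨c + d, add_pos hc hd, fun n => ?_⟩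
  have h1 : n • |φ + ψ| ≤ n • |φ| + n • |ψ| := by
    rw [← nsmul_add]
    exact nsmul_le_nsmul_right (abs_add_le _ _) n
  refine (inf_le_inf_left _ h1).trans ((inf_add_le (abs_nonneg x) (nsmul_nonneg (abs_nonneg _) _)
    (nsmul_nonneg (abs_nonneg _) _)).trans ((add_le_add (hcx n) (hdx n)).trans ?_))
  rw [smul_add]
  exact add_le_add (smul_le_smul_of_nonneg_right (le_add_of_nonneg_right hd.le) hφ.1)
    (smul_le_smul_of_nonneg_right (le_add_of_nonneg_left hc.le) hψ.1)

theorem IsMajorant.of_smul {k : ℝ} {z φ : V} (hk : 0 < k) (hz : 0 ≤ z)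
    (h : IsMajorant (k • z) φ) : IsMajorant z φ := by
  refine ⟨hz, fun x => ?_⟩
  obtain ⟨c, hc, hx⟩ := h.2 x
  exact ⟨c * k, mul_pos hc hk, fun n => by rw [mul_smul]; exact hx n⟩

theorem isSolid_finiteElements : LatticeOrderedAddCommGroup.IsSolid (finiteElements V) :=
  fun _ ⟨z, hz⟩ _ h => ⟨z, hz.of_abs_le h⟩

theorem isSolid_totallyFiniteElements :
    LatticeOrderedAddCommGroup.IsSolid (totallyFiniteElements V) :=
  fun _ ⟨z, hz, hzφ⟩ _ h => ⟨z, hz, hzφ.of_abs_le h⟩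

theorem add_mem_finiteElements {φ ψ : V} (hφ : φ ∈ finiteElements V)
    (hψ : ψ ∈ finiteElements V) : φ + ψ ∈ finiteElements V := by
  obtain ⟨y, hy⟩ := hφ
  obtain ⟨z, hz⟩ := hψ
  exact ⟨y + z, hy.add hz⟩

theorem add_mem_totallyFiniteElements {φ ψ : V} (hφ : φ ∈ totallyFiniteElements V)
    (hψ : ψ ∈ totallyFiniteElements V) : φ + ψ ∈ totallyFiniteElements V := by
  obtain ⟨y, hy, hyφ⟩ := hφ
  obtain ⟨z, hz, hzψ⟩ := hψ
  exact ⟨y + z, add_mem_finiteElements hy hz, hyφ.add hzψ⟩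

theorem mem_positiveSelfMajorizing {φ : V} :
    φ ∈ positiveSelfMajorizing V ↔ IsMajorant φ φ := by
  refine ⟨fun ⟨h0, h⟩ => ?_, fun h => ⟨h.1, ?_⟩⟩
  · rwa [abs_of_nonneg h0] at h
  · rwa [abs_of_nonneg h.1]

/-- This form makes solidity evident. For the converse, `φ = (φ⁺ + s) - (φ⁻ + s)`, where both terms
are majorized by `s` and lie above it. -/
theorem mem_selfMajorizingDifferences {φ : V} :
    φ ∈ selfMajorizingDifferences V ↔ ∃ s, IsMajorant s s ∧ |φ| ≤ s := by
  constructor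
  · rintro ⟨s, hs, t, ht, rfl⟩
    rw [mem_positiveSelfMajorizing] at hs ht
    exact ⟨s + t, hs.add ht, abs_sub_le_add hs.1 ht.1⟩
  · rintro ⟨s, hs, hφ⟩
    have key : ∀ x : V, 0 ≤ x → x ≤ s → x + s ∈ positiveSelfMajorizing V := by
      intro x hx0 hxs
      rw [mem_positiveSelfMajorizing]
      have hx : IsMajorant s x := hs.of_abs_le (by rwa [abs_of_nonneg hx0, abs_of_nonneg hs.1])
      refine IsMajorant.of_le (IsMajorant.of_smul two_pos hs.1 ?_) (le_add_of_nonneg_left hx0)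
      rw [two_smul]
      exact hx.add hs
    refine ⟨_, key φ⁺ (posPart_nonneg φ) ?_, _, key φ⁻ (negPart_nonneg φ) ?_, ?_⟩
    · exact (sup_le (le_abs_self φ) (abs_nonneg φ)).trans hφ
    · exact (sup_le (neg_le_abs φ) (abs_nonneg φ)).trans hφ
    · rw [add_sub_add_right_eq_sub, posPart_sub_negPart]

theorem isSolid_selfMajorizingDifferences :
    LatticeOrderedAddCommGroup.IsSolid (selfMajorizingDifferences V) := by
  intro φ hφ ψ h
  rw [mem_selfMajorizingDifferences] at hφ ⊢
  obtain ⟨s, hs, hφs⟩ := hφ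
  exact ⟨s, hs, h.trans hφs⟩

theorem add_mem_selfMajorizingDifferences {φ ψ : V} (hφ : φ ∈ selfMajorizingDifferences V)
    (hψ : ψ ∈ selfMajorizingDifferences V) : φ + ψ ∈ selfMajorizingDifferences V := by
  rw [mem_selfMajorizingDifferences] at hφ hψ ⊢
  obtain ⟨s, hs, hφs⟩ := hφ
  obtain ⟨t, ht, hψt⟩ := hψ
  exact ⟨s + t, hs.add ht, (abs_add_le _ _).trans (add_le_add hφs hψt)⟩

end FiniteElements

/-! ### The subalgebra of powers and the transfer of majorants -/

section PowerSubalgebra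

variable {A : Type*} [NonUnitalCommRing A] [Lattice A]

theorem succPow_mul_mem_foldProducts (n : ℕ) {S : Set A} {u v : A} (hu : u ∈ S) (hv : v ∈ S) :
    succPow n u * v ∈ foldProducts (n + 2) S := by
  refine ⟨Fin.snoc (α := fun _ => A) (fun _ => u) v, fun i => ?_, ?_⟩
  · refine Fin.lastCases ?_ (fun j => ?_) i
    · simpa using hv
    · simpa using hu
  · simp only [foldProd, Fin.snoc_castSucc, Fin.snoc_last, foldProd_const]

theorem succPow_add_of_mul_eq_zero (n : ℕ) {c d : A} (h : c * d = 0) :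
    succPow n (c + d) = succPow n c + succPow n d := by
  have hz : ∀ x y : A, x * y = 0 → ∀ n, succPow n x * y = 0 := by
    intro x y hxy n
    cases n with
    | zero => exact hxy
    | succ n => rw [succPow, mul_assoc, hxy, mul_zero]
  induction n with
  | zero => rfl
  | succ n ih =>
    rw [succPow, ih, add_mul, mul_add, mul_add, hz c d h n, hz d c (mul_comm c d ▸ h) n, add_zero,
      zero_add, succPow, succPow]

variable [IsOrderedAddMonoid A] [Module ℝ A] [PosSMulMono ℝ A] [IsScalarTower ℝ A A]
  [SMulCommClass ℝ A A] [PosMulMono A] [MulPosMono A]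

/-- The lattice subalgebra of differences of `(n + 1)`-st powers of positive elements. -/
def powerSubalgebra (hA : IsFAlgebra A) (harch : IsArchimedeanLattice A)
    (hcomplete : IsUniformlyComplete A) (hs : IsSemiprimeAlgebra A) (n : ℕ) :
    LatticeSubalgebra A :=
  have hadd {a b : A} (ha : 0 ≤ a) (hb : 0 ≤ b) :=
    exists_succPow_eq_add hA harch hcomplete hs n ha hb
  { carrier := {y | ∃ a b : A, 0 ≤ a ∧ 0 ≤ b ∧ succPow n a - succPow n b = y}
    add_mem' := by
      rintro _ _ ⟨a, b, ha, hb, rfl⟩ ⟨c, d, hc, hd, rfl⟩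
      obtain ⟨x, hx, hx'⟩ := hadd ha hc
      obtain ⟨y, hy, hy'⟩ := hadd hb hd
      exact ⟨x, y, hx, hy, by rw [hx', hy', add_sub_add_comm]⟩
    zero_mem' := ⟨0, 0, le_rfl, le_rfl, sub_self _⟩
    mul_mem' := by
      rintro _ _ ⟨a, b, ha, hb, rfl⟩ ⟨c, d, hc, hd, rfl⟩
      obtain ⟨x, hx, hx'⟩ := hadd (mul_nonneg ha hc) (mul_nonneg hb hd)
      obtain ⟨y, hy, hy'⟩ := hadd (mul_nonneg ha hd) (mul_nonneg hb hc)
      refine ⟨x, y, hx, hy, ?_⟩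
      simp only [hx', hy', succPow_mul, mul_sub, sub_mul]
      abel
    smul_mem' := by
      rintro c _ ⟨a, b, ha, hb, rfl⟩
      obtain ⟨r, hr, hrc⟩ : ∃ r : ℝ, 0 ≤ r ∧ r ^ (n + 1) = |c| :=
        ⟨|c| ^ (((n + 1 : ℕ) : ℝ)⁻¹), Real.rpow_nonneg (abs_nonneg c) _,
          Real.rpow_inv_natCast_pow (abs_nonneg c) (by omega)⟩
      rcases le_total 0 c with h | h
      · refine ⟨r • a, r • b, smul_nonneg hr ha, smul_nonneg hr hb, ?_⟩
        rw [succPow_smul, succPow_smul, hrc, abs_of_nonneg h, smul_sub]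
      · refine ⟨r • b, r • a, smul_nonneg hr hb, smul_nonneg hr ha, ?_⟩
        rw [succPow_smul, succPow_smul, hrc, abs_of_nonpos h, neg_smul, neg_smul, smul_sub]
        abel
    sup_mem' := by
      rintro _ _ ⟨a, b, ha, hb, rfl⟩ ⟨c, d, hc, hd, rfl⟩
      obtain ⟨x, hx, hx'⟩ := hadd ha hd
      obtain ⟨y, hy, hy'⟩ := hadd hc hb
      obtain ⟨z, hz, hz'⟩ := hadd hb hd
      -- Both differences are brought to the common subtrahend `b ^ (n + 1) + d ^ (n + 1)`.
      refine ⟨x ⊔ y, z, hx.trans le_sup_left, hz, ?_⟩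
      rw [hA.succPow_sup n hx hy, hx', hy', hz', sup_sub, add_comm (succPow n b),
        add_sub_add_right_eq_sub, add_comm (succPow n d), add_sub_add_right_eq_sub]
    inf_mem' := by
      rintro _ _ ⟨a, b, ha, hb, rfl⟩ ⟨c, d, hc, hd, rfl⟩
      obtain ⟨x, hx, hx'⟩ := hadd ha hd
      obtain ⟨y, hy, hy'⟩ := hadd hc hb
      obtain ⟨z, hz, hz'⟩ := hadd hb hd
      refine ⟨x ⊓ y, z, le_inf hx hy, hz, ?_⟩
      rw [hA.succPow_inf n hx hy, hx', hy', hz', inf_sub, add_comm (succPow n b),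
        add_sub_add_right_eq_sub, add_comm (succPow n d), add_sub_add_right_eq_sub] }

/-- `P` is a lattice subalgebra whose positive elements are the `(n + 1)`-st powers of the positive
elements of `A`. -/
structure IsPowerCone (P : LatticeSubalgebra A) (n : ℕ) : Prop where
  succPow_mem : ∀ {a : A}, 0 ≤ a → succPow n a ∈ P.toNonUnitalSubalgebra
  exists_root : ∀ {y : A}, y ∈ P.toNonUnitalSubalgebra → 0 ≤ y → ∃ w, 0 ≤ w ∧ succPow n w = y

theorem isPowerCone_powerSubalgebra (hA : IsFAlgebra A) (harch : IsArchimedeanLattice A)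
    (hcomplete : IsUniformlyComplete A) (hs : IsSemiprimeAlgebra A) (n : ℕ) :
    IsPowerCone (powerSubalgebra hA harch hcomplete hs n) n where
  succPow_mem {a} ha := by
    refine ⟨a, 0, ha, le_rfl, ?_⟩
    have : succPow n (0 : A) = 0 := by cases n <;> simp [succPow]
    rw [this, sub_zero]
  exists_root := by
    rintro _ ⟨a, b, ha, hb, rfl⟩ hy
    exact exists_succPow_eq_sub hA harch hcomplete hs n hb
      (hs.le_of_succPow_le hA n hb ha (sub_nonneg.1 hy))

theorem foldProd_mem_powerSubalgebra (hA : IsFAlgebra A) (harch : IsArchimedeanLattice A)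
    (hcomplete : IsUniformlyComplete A) (hs : IsSemiprimeAlgebra A) (n : ℕ) (g : Fin (n + 1) → A) :
    foldProd (n + 1) g ∈ (powerSubalgebra hA harch hcomplete hs n).toNonUnitalSubalgebra := by
  induction n with
  | zero =>
    exact ⟨(g 0)⁺, (g 0)⁻, posPart_nonneg _, negPart_nonneg _, posPart_sub_negPart _⟩
  | succ n ih =>
    obtain ⟨a, b, ha, hb, hab⟩ := ih fun i => g i.castSucc
    have hmem {x y : A} (hx : 0 ≤ x) (hy : 0 ≤ y) : succPow n x * y ∈
        (powerSubalgebra hA harch hcomplete hs (n + 1)).toNonUnitalSubalgebra := by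
      obtain ⟨w, hw, hw'⟩ := exists_succPow_eq_mul hA harch hcomplete hs n hx hy
      exact hw' ▸ (isPowerCone_powerSubalgebra hA harch hcomplete hs (n + 1)).succPow_mem hw
    rw [foldProd, ← hab, ← posPart_sub_negPart (g (Fin.last (n + 1))), sub_mul, mul_sub, mul_sub]
    have hp := posPart_nonneg (g (Fin.last (n + 1)))
    have hn := negPart_nonneg (g (Fin.last (n + 1)))
    exact sub_mem (sub_mem (hmem ha hp) (hmem ha hn)) (sub_mem (hmem hb hp) (hmem hb hn))

variable {P : LatticeSubalgebra A} {n : ℕ}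

/-- The roots `c`, `d` of `y⁺`, `y⁻` are disjoint, so all mixed products vanish. The single factor
`c - d` carries the sign, whatever the parity of the exponent. -/
theorem IsPowerCone.exists_eq_succPow_mul (hP : IsPowerCone P (n + 1)) (hA : IsFAlgebra A)
    (hs : IsSemiprimeAlgebra A) {y : A} (hy : y ∈ P.toNonUnitalSubalgebra) :
    ∃ c d : A, 0 ≤ c ∧ 0 ≤ d ∧ succPow n (c + d) * (c - d) = y ∧
      succPow (n + 1) (c + d) = |y| := by
  have h0 := P.toNonUnitalSubalgebra.zero_mem
  obtain ⟨c, hc, hcy⟩ := hP.exists_root (P.sup_mem' hy h0) (posPart_nonneg y)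
  obtain ⟨d, hd, hdy⟩ := hP.exists_root
    (P.sup_mem' (P.toNonUnitalSubalgebra.neg_mem hy) h0) (negPart_nonneg y)
  have hcd : c ⊓ d = 0 := by
    refine le_antisymm (hs.le_of_succPow_le hA (n + 1) (le_inf hc hd) le_rfl ?_) (le_inf hc hd)
    rw [hA.succPow_inf _ hc hd, hcy, hdy, succPow_succ, mul_zero]
    exact (posPart_inf_negPart_eq_zero y).le
  have hmul := hA.mul_eq_zero_of_disjoint hcd
  refine ⟨c, d, hc, hd, ?_, ?_⟩
  · rw [← posPart_sub_negPart y]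
    refine Eq.trans ?_ (congrArg₂ (· - ·) hcy hdy)
    have h1 : succPow n c * d = 0 := by
      cases n with
      | zero => exact hmul
      | succ n => rw [succPow, mul_assoc, hmul, mul_zero]
    have h2 : succPow n d * c = 0 := by
      rw [mul_comm] at hmul
      cases n with
      | zero => exact hmul
      | succ n => rw [succPow, mul_assoc, hmul, mul_zero]
    simp only [succPow_add_of_mul_eq_zero n hmul, add_mul, mul_sub, h1, h2, succPow_succ]
    abel
  · rw [succPow_add_of_mul_eq_zero _ hmul, hcy, hdy]
    exact posPart_add_negPart y

/-- The power map carries the truncations `x ⊓ k • w` to truncations in `P`, and constants pass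
through powers and real roots. -/
theorem IsPowerCone.isMajorant_iff (hP : IsPowerCone P n) (hA : IsFAlgebra A)
    (hs : IsSemiprimeAlgebra A) {z w : A} (hz : 0 ≤ z) (hw : 0 ≤ w)
    {Z W : P.toNonUnitalSubalgebra} (hZ : succPow n z = Z) (hW : succPow n w = W) :
    IsMajorant Z W ↔ IsMajorant z w := by
  have hW0 : 0 ≤ (W : A) := hW ▸ succPow_nonneg n hw
  have hinf {x : A} (hx : 0 ≤ x) (k : ℕ) :
      succPow n (x ⊓ k • w) = succPow n x ⊓ k ^ (n + 1) • (W : A) := by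
    rw [hA.succPow_inf n hx (nsmul_nonneg hw k), ← Nat.cast_smul_eq_nsmul ℝ, succPow_smul, hW,
      ← Nat.cast_pow, Nat.cast_smul_eq_nsmul]
  constructor
  · intro h
    refine ⟨hz, fun x => ?_⟩
    obtain ⟨c, hc, hcx⟩ := h.2 ⟨_, hP.succPow_mem (abs_nonneg x)⟩
    obtain ⟨r, hr, hrc⟩ : ∃ r : ℝ, 0 < r ∧ r ^ (n + 1) = c :=
      ⟨c ^ (((n + 1 : ℕ) : ℝ)⁻¹), Real.rpow_pos_of_pos hc _,
        Real.rpow_inv_natCast_pow hc.le (by omega)⟩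
    refine ⟨r, hr, fun k => ?_⟩
    rw [abs_of_nonneg hw]
    refine hs.le_of_succPow_le hA n (le_inf (abs_nonneg x) (nsmul_nonneg hw k))
      (smul_nonneg hr.le hz) ?_
    have h1 : abs (succPow n |x|) ⊓ k ^ (n + 1) • |(W : A)| ≤ c • (Z : A) := hcx (k ^ (n + 1))
    rw [abs_of_nonneg hW0, abs_of_nonneg (succPow_nonneg n (abs_nonneg x))] at h1
    rwa [hinf (abs_nonneg x), succPow_smul, hrc, hZ]
  · intro h
    refine ⟨show 0 ≤ (Z : A) from hZ ▸ succPow_nonneg n hz, fun X => ?_⟩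
    have hX : |(X : A)| ∈ P.toNonUnitalSubalgebra :=
      P.sup_mem' X.2 (P.toNonUnitalSubalgebra.neg_mem X.2)
    obtain ⟨x, hx, hxX⟩ := hP.exists_root hX (abs_nonneg _)
    obtain ⟨c, hc, hcx⟩ := h.2 x
    refine ⟨c ^ (n + 1), pow_pos hc _, fun k => ?_⟩
    change |(X : A)| ⊓ k • |(W : A)| ≤ c ^ (n + 1) • (Z : A)
    have h1 := hcx k
    rw [abs_of_nonneg hx, abs_of_nonneg hw] at h1
    have h2 := succPow_le_succPow n (le_inf hx (nsmul_nonneg hw k)) h1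
    rw [hinf hx, succPow_smul, hZ, hxX] at h2
    rw [abs_of_nonneg hW0]
    -- Only multiples `k ^ (n + 1)` arise from powers; they suffice because `k ≤ k ^ (n + 1)`.
    exact (inf_le_inf_left _
      (nsmul_le_nsmul_left hW0 (Nat.le_self_pow (by omega) k))).trans h2

theorem IsPowerCone.mem_finiteElements_iff (hP : IsPowerCone P n) (hA : IsFAlgebra A)
    (hs : IsSemiprimeAlgebra A) {w : A} (hw : 0 ≤ w) {W : P.toNonUnitalSubalgebra}
    (hW : succPow n w = W) :
    W ∈ finiteElements P.toNonUnitalSubalgebra ↔ w ∈ finiteElements A := by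
  constructor
  · rintro ⟨Z, hZ⟩
    obtain ⟨z, hz, hzZ⟩ := hP.exists_root Z.2 hZ.1
    exact ⟨z, (hP.isMajorant_iff hA hs hz hw hzZ hW).1 hZ⟩
  · rintro ⟨z, hz⟩
    exact ⟨⟨_, hP.succPow_mem hz.1⟩, (hP.isMajorant_iff hA hs hz.1 hw rfl hW).2 hz⟩

theorem IsPowerCone.mem_totallyFiniteElements_iff (hP : IsPowerCone P n) (hA : IsFAlgebra A)
    (hs : IsSemiprimeAlgebra A) {w : A} (hw : 0 ≤ w) {W : P.toNonUnitalSubalgebra}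
    (hW : succPow n w = W) :
    W ∈ totallyFiniteElements P.toNonUnitalSubalgebra ↔ w ∈ totallyFiniteElements A := by
  constructor
  · rintro ⟨Z, hZf, hZ⟩
    obtain ⟨z, hz, hzZ⟩ := hP.exists_root Z.2 hZ.1
    exact ⟨z, (hP.mem_finiteElements_iff hA hs hz hzZ).1 hZf,
      (hP.isMajorant_iff hA hs hz hw hzZ hW).1 hZ⟩
  · rintro ⟨z, hzf, hz⟩
    exact ⟨⟨_, hP.succPow_mem hz.1⟩, (hP.mem_finiteElements_iff hA hs hz.1 rfl).2 hzf,
      (hP.isMajorant_iff hA hs hz.1 hw rfl hW).2 hz⟩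

theorem IsPowerCone.mem_selfMajorizingDifferences_iff (hP : IsPowerCone P n) (hA : IsFAlgebra A)
    (hs : IsSemiprimeAlgebra A) {w : A} (hw : 0 ≤ w) {W : P.toNonUnitalSubalgebra}
    (hW : succPow n w = W) :
    W ∈ selfMajorizingDifferences P.toNonUnitalSubalgebra ↔ w ∈ selfMajorizingDifferences A := by
  have hW0 : 0 ≤ W := show (0 : A) ≤ W from hW ▸ succPow_nonneg n hw
  rw [mem_selfMajorizingDifferences, mem_selfMajorizingDifferences, abs_of_nonneg hw,
    abs_of_nonneg hW0]
  constructor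
  · rintro ⟨Z, hZ, hWZ⟩
    obtain ⟨z, hz, hzZ⟩ := hP.exists_root Z.2 hZ.1
    refine ⟨z, (hP.isMajorant_iff hA hs hz hz hzZ hzZ).1 hZ, hs.le_of_succPow_le hA n hw hz ?_⟩
    rw [hW, hzZ]
    exact hWZ
  · rintro ⟨z, hz, hwz⟩
    refine ⟨⟨_, hP.succPow_mem hz.1⟩, (hP.isMajorant_iff hA hs hz.1 hz.1 rfl rfl).2 hz, ?_⟩
    change (W : A) ≤ succPow n z
    exact hW ▸ succPow_le_succPow n hw hwz

/-- Take for `u` the sum of the `|g i|`, which dominates every factor. -/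
theorem exists_abs_foldProd_le {Φ : Set A} (hΦ : LatticeOrderedAddCommGroup.IsSolid Φ)
    (hadd : ∀ {a b : A}, a ∈ Φ → b ∈ Φ → a + b ∈ Φ) (n : ℕ) (g : Fin (n + 1) → A)
    (hg : ∀ i, g i ∈ Φ) : ∃ u ∈ Φ, 0 ≤ u ∧ |foldProd (n + 1) g| ≤ succPow n u := by
  have habs (i) : |g i| ∈ Φ := hΦ (hg i) (abs_abs (g i)).le
  induction n with
  | zero => exact ⟨|g 0|, habs 0, abs_nonneg _, le_rfl⟩
  | succ n ih =>
    obtain ⟨u, hu, hu0, hgu⟩ := ih (fun i => g i.castSucc) (fun i => hg _) fun i => habs _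
    have hl := abs_nonneg (g (Fin.last (n + 1)))
    have h0 := add_nonneg hu0 hl
    refine ⟨u + |g (Fin.last (n + 1))|, hadd hu (habs _), h0, ?_⟩
    exact (abs_mul_le_mul_abs _ _).trans (mul_le_mul
      (hgu.trans (succPow_le_succPow n hu0 (le_add_of_nonneg_right hl)))
      (le_add_of_nonneg_left hu0) hl (succPow_nonneg n h0))

/-- The products of elements of an ideal of `A` form the ideal of `P` that corresponds to it under
`w ↦ w ^ (n + 2)`. -/
theorem IsPowerCone.foldProducts_eq_image (hP : IsPowerCone P (n + 1)) (hA : IsFAlgebra A)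
    (hs : IsSemiprimeAlgebra A)
    (hfold : ∀ g : Fin (n + 2) → A, foldProd (n + 2) g ∈ P.toNonUnitalSubalgebra)
    {Φ : Set A} {Ψ : Set P.toNonUnitalSubalgebra} (hΦ : LatticeOrderedAddCommGroup.IsSolid Φ)
    (hadd : ∀ {a b : A}, a ∈ Φ → b ∈ Φ → a + b ∈ Φ) (hΨ : LatticeOrderedAddCommGroup.IsSolid Ψ)
    (h : ∀ {w : A}, 0 ≤ w → ∀ {W : P.toNonUnitalSubalgebra}, succPow (n + 1) w = W →
      (W ∈ Ψ ↔ w ∈ Φ)) :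
    foldProducts (n + 2) Φ = Subtype.val '' Ψ := by
  ext y
  constructor
  · rintro ⟨g, hg, rfl⟩
    obtain ⟨u, hu, hu0, hgu⟩ := exists_abs_foldProd_le hΦ hadd (n + 1) g hg
    refine ⟨⟨_, hfold g⟩, hΨ ((h hu0 (W := ⟨_, hP.succPow_mem hu0⟩) rfl).2 hu) ?_, rfl⟩
    exact hgu.trans (le_abs_self (succPow (n + 1) u))
  · rintro ⟨Y, hY, rfl⟩
    obtain ⟨c, d, hc, hd, hcd, hcd'⟩ := hP.exists_eq_succPow_mul hA hs Y.2
    have hmem : c + d ∈ Φ :=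
      (h (add_nonneg hc hd) (W := |Y|) hcd').1 (hΨ hY (abs_abs Y).le)
    -- All factors but the last are `c + d`; the last, `c - d`, lies in `Φ` by solidity.
    rw [← hcd]
    refine succPow_mul_mem_foldProducts n hmem (hΦ hmem ?_)
    rw [abs_of_nonneg (add_nonneg hc hd)]
    exact abs_sub_le_add hc hd

/-- The commutative case of the main result. -/
theorem exists_latticeSubalgebra_foldProducts_eq (hA : IsFAlgebra A)
    (harch : IsArchimedeanLattice A) (hcomplete : IsUniformlyComplete A)
    (hs : IsSemiprimeAlgebra A) (n : ℕ) :
    ∃ P : LatticeSubalgebra A,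
      (P.toNonUnitalSubalgebra : Set A) = foldProducts (n + 2) Set.univ ∧
      foldProducts (n + 2) (finiteElements A) =
        Subtype.val '' finiteElements P.toNonUnitalSubalgebra ∧
      foldProducts (n + 2) (totallyFiniteElements A) =
        Subtype.val '' totallyFiniteElements P.toNonUnitalSubalgebra ∧
      foldProducts (n + 2) (selfMajorizingDifferences A) =
        Subtype.val '' selfMajorizingDifferences P.toNonUnitalSubalgebra := by
  have hP := isPowerCone_powerSubalgebra hA harch hcomplete hs (n + 1)
  have hfold := foldProd_mem_powerSubalgebra hA harch hcomplete hs (n + 1)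
  refine ⟨powerSubalgebra hA harch hcomplete hs (n + 1), ?_, ?_, ?_, ?_⟩
  · ext y
    constructor
    · intro hy
      obtain ⟨c, d, -, -, rfl, -⟩ := hP.exists_eq_succPow_mul hA hs hy
      exact succPow_mul_mem_foldProducts n trivial trivial
    · rintro ⟨g, -, rfl⟩
      exact hfold g
  · exact hP.foldProducts_eq_image hA hs hfold isSolid_finiteElements add_mem_finiteElements
      isSolid_finiteElements fun hw _ hW => hP.mem_finiteElements_iff hA hs hw hW
  · exact hP.foldProducts_eq_image hA hs hfold isSolid_totallyFiniteElements
      add_mem_totallyFiniteElements isSolid_totallyFiniteElements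
      fun hw _ hW => hP.mem_totallyFiniteElements_iff hA hs hw hW
  · exact hP.foldProducts_eq_image hA hs hfold isSolid_selfMajorizingDifferences
      add_mem_selfMajorizingDifferences isSolid_selfMajorizingDifferences
      fun hw _ hW => hP.mem_selfMajorizingDifferences_iff hA hs hw hW

end PowerSubalgebra

theorem corollary7 {A : Type*} [NonUnitalRing A] [Lattice A] [IsOrderedAddMonoid A]
    [Module ℝ A] [PosSMulMono ℝ A] [IsScalarTower ℝ A A] [SMulCommClass ℝ A A]
    (hA : IsFAlgebra A) (harch : IsArchimedeanLattice A) (hcomplete : IsUniformlyComplete A)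
    (hsemiprime : IsSemiprimeAlgebra A) (p : ℕ) (hp : 2 ≤ p) :
    ∃ P : LatticeSubalgebra A,
      (P.toNonUnitalSubalgebra : Set A) = foldProducts p Set.univ ∧
      foldProducts p (finiteElements A) =
        Subtype.val '' finiteElements P.toNonUnitalSubalgebra ∧
      foldProducts p (totallyFiniteElements A) =
        Subtype.val '' totallyFiniteElements P.toNonUnitalSubalgebra ∧
      foldProducts p (selfMajorizingDifferences A) =
        Subtype.val '' selfMajorizingDifferences P.toNonUnitalSubalgebra := by
  obtain ⟨n, rfl⟩ := Nat.exists_eq_add_of_le' hp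
  let _ : NonUnitalCommRing A := { ‹NonUnitalRing A› with mul_comm := hA.mul_comm harch }
  have _ : PosMulMono A := hA.posMulMono
  have _ : MulPosMono A := hA.mulPosMono
  exact exists_latticeSubalgebra_foldProducts_eq hA harch hcomplete hsemiprime n
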